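/- In the entanglement game with $k$ cops on a finite graph $G$, the robber first chooses a starting vertex, and all cops are outside the graph. In every turn, either all cops stay where they are or one of them flies to the current position of the robber; in both cases the robber must then move to a neighbour of his current position that is not occupied by a cop. The cops win if the robber has no such move, and the robber wins if he can run away indefinitely. We say that $k$ cops suffice to catch the robber on $G$ if they have a strategy that wins against every choice of starting vertex and moves of the robber. There is a constant $\alpha>0$ such that the following holds. For even $n$, let $M_1,M_2,M_3$ be independent, uniformly random perfect matchings on a common set of $n$ vertices, and let $G=M_1\cup M_2\cup M_3$. Then, with high probability (that is, with probability tending to $1$ as $n\to\infty$ along the even integers), $\alpha n$ cops do not suffice to catch the robber on $G$, i.e. no number $k\le\alpha n$ of cops suffices. In fact, this event has probability at least $1-e^{-\Omega(n)}$: there are constants $c>0$ and $n_0$ such that for all even $n\ge n_0$, $$\mathbb{P}\bigl(\text{no number } k\le \alpha n \text{ of cops suffices to catch the robber on } G\bigr)\ \ge\ 1-e^{-cn}.$$ -/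

import Mathlib

open Filter Topology MeasureTheory ProbabilityTheory

/-- A (deterministic) strategy of `k` cops in the entanglement game on the vertex set `V`: after the
robber has visited the vertices `h 0, …, h t` (the last one being his current position), the cops
decide either that nobody moves (`none`) or that cop `i` flies to `h t` (`some i`). -/
def CopStrategy (V : Type*) (k : ℕ) : Type _ :=
  (t : ℕ) → (Fin (t + 1) → V) → Option (Fin k)

/-- The positions of the cops before their turn number `t`, when they follow the strategy `σ` and the
robber visits `r 0, r 1, r 2, …`. The value `none` means that the cop is still outside the graph.
Initially all cops are outside; in turn `t` either all cops stay where they are or one cop flies to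
the current position `r t` of the robber. -/
def copPositions {V : Type*} {k : ℕ} (σ : CopStrategy V k) (r : ℕ → V) : ℕ → Fin k → Option V
  | 0 => fun _ => none
  | t + 1 =>
    match σ t (fun s => r s) with
    | none => copPositions σ r t
    | some i => Function.update (copPositions σ r t) i (some (r t))

/-- The infinite sequence `r` of positions is a legal way for the robber to run away forever from
cops that follow the strategy `σ`: after each turn of the cops he moves to a neighbour of his
current position which is not occupied by a cop. -/
def RobberEscapes {V : Type*} (G : SimpleGraph V) {k : ℕ} (σ : CopStrategy V k) (r : ℕ → V) : Prop :=
  ∀ t : ℕ, G.Adj (r t) (r (t + 1)) ∧ ∀ i : Fin k, copPositions σ r (t + 1) i ≠ some (r (t + 1))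

/-- `k` cops suffice to catch the robber in the entanglement game on `G`: they have a strategy
against which the robber, whatever his starting position and his moves, cannot run away
indefinitely, i.e. sooner or later he has no legal move. -/
def CopsSuffice {V : Type*} (G : SimpleGraph V) (k : ℕ) : Prop :=
  ∃ σ : CopStrategy V k, ∀ r : ℕ → V, ¬ RobberEscapes G σ r

/-- The perfect matchings of the complete graph on `V`. -/
def PerfectMatching (V : Type*) : Type _ :=
  {M : (⊤ : SimpleGraph V).Subgraph // M.IsPerfectMatching}

instance (V : Type*) [Finite V] : Finite (PerfectMatching V) :=
  inferInstanceAs (Finite {M : (⊤ : SimpleGraph V).Subgraph // M.IsPerfectMatching})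

instance (V : Type*) : MeasurableSpace (PerfectMatching V) := ⊤

instance (V : Type*) : DiscreteMeasurableSpace (PerfectMatching V) := ⟨fun _ => trivial⟩

/-- The graph `M₁ ∪ M₂ ∪ M₃` on the vertex set `V`. -/
def matchingUnion {V : Type*} (M : Fin 3 → PerfectMatching V) : SimpleGraph V :=
  ⨆ i, (M i).1.spanningCoe

/-- The joint law of three independent perfect matchings, each of them uniformly distributed on the
set of all perfect matchings of the complete graph on `n` vertices (`n` even). -/
noncomputable def threeMatchings (n : ℕ) : Measure (Fin 3 → PerfectMatching (Fin n)) :=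
  Measure.pi fun _ => uniformOn Set.univ

/-! A graph without small balanced separators lets the robber escape. For a set `C` of at most `c`
vertices, the large sets (more than two thirds of all vertices) closed off by `C` have a least
member β(C), since two of them meet in more than a third and hence again in a large set. The robber
keeps inside β(C), where `C` is the set of occupied vertices
(`SimpleGraph.NoBalancedSeparator.not_copsSuffice`).

That `matchingUnion M` has no such separator is a union bound over at most 2^n sets `A`. If few
vertices close off `A`, each of the three matchings has few edges leaving `A`. By symmetry and
double counting, one random matching does so with probability at most 2^(n/2) · e^(εn) / C(n,|A|),
and C(n,|A|) ≥ 6^⌊n/3⌋ / 3 for balanced `A`. Cubing by independence gives, up to a constant, 2^n ·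
2^(3n/2) · e^(3εn) / 6^n = (8/9)^(n/2) · e^(3εn), which decays exponentially for small ε. -/

/-- The vertex set `A` is disjoint from `C`, and `C` contains all neighbours of `A` outside `A`. -/
def SimpleGraph.IsClosedOff {V : Type*} (G : SimpleGraph V) (C A : Finset V) : Prop :=
  Disjoint A C ∧ ∀ v ∈ A, ∀ w, G.Adj v w → w ∈ A ∨ w ∈ C

/-- No set of at most `c` vertices closes off a set containing between one third and two thirds of
all the vertices. -/
def SimpleGraph.NoBalancedSeparator {V : Type*} [Fintype V] (G : SimpleGraph V) (c : ℕ) : Prop :=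
  ∀ C A : Finset V, C.card ≤ c → G.IsClosedOff C A →
    3 * A.card < Fintype.card V ∨ 2 * Fintype.card V < 3 * A.card

/-! ### The robber's strategy in the absence of balanced separators -/

section Game

variable {V : Type*} {G : SimpleGraph V}

theorem SimpleGraph.IsClosedOff.inter [DecidableEq V] {C A B : Finset V}
    (hA : G.IsClosedOff C A) (hB : G.IsClosedOff C B) : G.IsClosedOff C (A ∩ B) := by
  refine ⟨hA.1.mono_left Finset.inter_subset_left, fun v hv w hvw => ?_⟩
  rw [Finset.mem_inter] at hv ⊢
  have h1 := hA.2 v hv.1 w hvw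
  have h2 := hB.2 v hv.2 w hvw
  tauto

theorem SimpleGraph.IsClosedOff.sdiff [DecidableEq V] {C D A : Finset V}
    (hA : G.IsClosedOff C A) (hCD : C ⊆ D) : G.IsClosedOff D (A \ D) := by
  refine ⟨Finset.sdiff_disjoint, fun v hv w hvw => ?_⟩
  rw [Finset.mem_sdiff] at hv ⊢
  have h1 := hA.2 v hv.1 w hvw
  have h2 := @hCD w
  tauto

theorem SimpleGraph.isClosedOff_compl [Fintype V] [DecidableEq V] (C : Finset V) :
    G.IsClosedOff C Cᶜ := by
  refine ⟨disjoint_compl_left, fun v _ w _ => ?_⟩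
  rw [Finset.mem_compl]
  tauto

/-- Among the large sets that `C` closes off, there is a least one. -/
theorem SimpleGraph.NoBalancedSeparator.exists_least [Fintype V] {c : ℕ}
    (hG : G.NoBalancedSeparator c) (hc : 3 * c < Fintype.card V) {C : Finset V} (hC : C.card ≤ c) :
    ∃ B : Finset V, G.IsClosedOff C B ∧ 2 * Fintype.card V < 3 * B.card ∧
      ∀ A : Finset V, G.IsClosedOff C A → 2 * Fintype.card V < 3 * A.card → B ⊆ A := by
  classical
  let F : Finset (Finset V) :=
    Finset.univ.filter fun A => G.IsClosedOff C A ∧ 2 * Fintype.card V < 3 * A.card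
  have hF : F.Nonempty := by
    refine ⟨Cᶜ, ?_⟩
    have := Finset.card_add_card_compl C
    simp only [F, Finset.mem_filter, Finset.mem_univ, true_and]
    exact ⟨SimpleGraph.isClosedOff_compl C, by omega⟩
  obtain ⟨B, hB, hmin⟩ := F.exists_min_image Finset.card hF
  simp only [F, Finset.mem_filter, Finset.mem_univ, true_and] at hB hmin
  refine ⟨B, hB.1, hB.2, fun A hA hA' => ?_⟩
  have hBA := hB.1.inter hA
  -- Two sets of more than 2n/3 vertices share more than n/3, so the dichotomy makes the
  -- intersection large and minimality of `B` applies.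
  have h1 := Finset.card_union_add_card_inter B A
  have h2 := Finset.card_le_univ (B ∪ A)
  have h3 := (hG C _ hC hBA).resolve_left (by omega)
  exact Finset.inter_eq_left.mp
    (Finset.eq_of_subset_of_card_le Finset.inter_subset_left (hmin _ ⟨hBA, h3⟩))

theorem copPositions_congr {k : ℕ} (σ : CopStrategy V k) {r r' : ℕ → V} :
    ∀ {t : ℕ}, (∀ s < t, r s = r' s) → copPositions σ r t = copPositions σ r' t
  | 0, _ => rfl
  | t + 1, h => by
    have h1 : (fun s : Fin (t + 1) => r s) = fun s : Fin (t + 1) => r' s :=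
      funext fun s => h s s.2
    simp only [copPositions, h1, h t (Nat.lt_succ_self t),
      copPositions_congr σ fun s hs => h s (hs.trans (Nat.lt_succ_self t))]

/-- Every rule telling the robber where to go next, depending on the positions of the cops before
their turn and on his own position, can be followed forever. -/
theorem exists_run {k : ℕ} (σ : CopStrategy V k) (v₀ : V) (next : (Fin k → Option V) → V → V) :
    ∃ r : ℕ → V, r 0 = v₀ ∧ ∀ t, r (t + 1) = next (copPositions σ r t) (r t) := by
  -- `R t` is correct up to time `t` and constant afterwards; the run is the diagonal.
  let R : ℕ → ℕ → V := fun t => Nat.rec (fun _ => v₀)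
    (fun t f => Function.update f (t + 1) (next (copPositions σ f t) (f t))) t
  have hR : ∀ t, R (t + 1) =
      Function.update (R t) (t + 1) (next (copPositions σ (R t) t) (R t t)) := fun t => rfl
  have hle : ∀ t s, s ≤ t → R t s = R s s := by
    intro t
    induction t with
    | zero => intro s hs; rw [Nat.le_zero.mp hs]
    | succ t ih =>
      intro s hs
      rcases hs.eq_or_lt with rfl | hs
      · rfl
      · rw [hR, Function.update_of_ne hs.ne, ih s (by omega)]
  refine ⟨fun t => R t t, rfl, fun t => ?_⟩
  have h1 : copPositions σ (R t) t = copPositions σ (fun s => R s s) t :=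
    copPositions_congr σ fun s hs => hle t s hs.le
  change R (t + 1) (t + 1) = _
  rw [hR, Function.update_self, h1]

/-- From `v` in `β C` the robber moves into `β (insert v C)`. Whatever the cops do, the new occupied
set lies in `insert v C`, and `β` is antitone, so the invariant survives. The extra vertex `v` is
why `k + 1 ≤ c` is needed. -/
theorem SimpleGraph.NoBalancedSeparator.not_copsSuffice [Fintype V] {c k : ℕ}
    (hG : G.NoBalancedSeparator c) (hc : 3 * c < Fintype.card V) (hk : k + 1 ≤ c) :
    ¬ CopsSuffice G k := by
  classical
  rintro ⟨σ, hσ⟩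
  have hex : ∀ C : Finset V, ∃ B : Finset V, C.card ≤ c →
      G.IsClosedOff C B ∧ 2 * Fintype.card V < 3 * B.card ∧
      ∀ A : Finset V, G.IsClosedOff C A → 2 * Fintype.card V < 3 * A.card → B ⊆ A := by
    intro C
    by_cases hC : C.card ≤ c
    · obtain ⟨B, hB⟩ := hG.exists_least hc hC
      exact ⟨B, fun _ => hB⟩
    · exact ⟨∅, fun h => absurd h hC⟩
  choose β hβ using hex
  have hanti : ∀ C D : Finset V, C ⊆ D → D.card ≤ c → β D ⊆ β C := by
    intro C D hCD hD
    have hC := (Finset.card_le_card hCD).trans hD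
    -- Removing `D` from `β C` leaves more than 2n/3 − n/3 vertices, so the remainder is large.
    have hcl := (hβ C hC).1.sdiff hCD
    refine ((hβ D hD).2.2 _ hcl ?_).trans Finset.sdiff_subset
    refine (hG D _ hD hcl).resolve_left ?_
    have := Finset.le_card_sdiff D (β C)
    have := (hβ C hC).2.1
    omega
  have hnext : ∀ (C : Finset V) (v : V), ∃ w, C.card ≤ k → v ∈ β C →
      G.Adj v w ∧ w ∈ β (insert v C) := by
    intro C v
    by_cases h : C.card ≤ k ∧ v ∈ β C
    · have hD : (insert v C).card ≤ c := (Finset.card_insert_le v C).trans (by omega)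
      by_contra! hno
      have hno' : ∀ w ∈ β (insert v C), ¬ G.Adj v w := fun w hw ha => (hno w).2.2 ha hw
      -- If `v` had no neighbour in `β (insert v C)`, then `C` alone would close that set off;
      -- leastness would put `v` into it, although it avoids `insert v C`.
      have hcl : G.IsClosedOff C (β (insert v C)) := by
        refine ⟨(hβ _ hD).1.1.mono_right (Finset.subset_insert v C), fun u hu w huw => ?_⟩
        have h1 := (hβ _ hD).1.2 u hu w huw
        rw [Finset.mem_insert] at h1
        rcases h1 with h1 | rfl | h1
        · exact Or.inl h1
        · exact absurd huw.symm (hno' u hu)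
        · exact Or.inr h1
      have hv := (hβ C (by omega)).2.2 _ hcl (hβ _ hD).2.1 h.2
      exact Finset.disjoint_left.mp (hβ _ hD).1.1 hv (Finset.mem_insert_self v C)
    · exact ⟨v, fun h1 h2 => absurd ⟨h1, h2⟩ h⟩
  choose next hnext using hnext
  let occ : (Fin k → Option V) → Finset V := fun p =>
    Finset.univ.filter fun v => ∃ i, p i = some v
  have mem_occ : ∀ p v, v ∈ occ p ↔ ∃ i, p i = some v := fun p v => by simp [occ]
  have hocc : ∀ p, (occ p).card ≤ k := by
    intro p
    have hsub : (occ p).map Function.Embedding.some ⊆ Finset.univ.image p := by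
      intro o ho
      rw [Finset.mem_map] at ho
      obtain ⟨v, hv, rfl⟩ := ho
      obtain ⟨i, hi⟩ := (mem_occ p v).mp hv
      exact Finset.mem_image.mpr ⟨i, Finset.mem_univ i, hi⟩
    calc (occ p).card = ((occ p).map Function.Embedding.some).card := (Finset.card_map _).symm
      _ ≤ (Finset.univ.image p).card := Finset.card_le_card hsub
      _ ≤ (Finset.univ : Finset (Fin k)).card := Finset.card_image_le
      _ = k := Finset.card_fin k
  have hempty : (∅ : Finset V).card ≤ c := by simp
  have hstart : (β ∅).Nonempty := by
    have := (hβ ∅ hempty).2.1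
    exact Finset.card_pos.mp (by omega)
  obtain ⟨v₀, hv₀⟩ := hstart
  obtain ⟨r, hr0, hr⟩ := exists_run σ v₀ fun p v => next (occ p) v
  have hmove : ∀ t, occ (copPositions σ r (t + 1)) ⊆ insert (r t) (occ (copPositions σ r t)) := by
    intro t v hv
    obtain ⟨i, hi⟩ := (mem_occ _ v).mp hv
    rw [Finset.mem_insert, mem_occ]
    cases hj : σ t fun s => r s with
    | none =>
      simp only [copPositions, hj] at hi
      exact Or.inr ⟨i, hi⟩
    | some j =>
      simp only [copPositions, hj] at hi
      by_cases hij : i = j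
      · subst hij
        rw [Function.update_self] at hi
        exact Or.inl (Option.some_injective _ hi).symm
      · rw [Function.update_of_ne hij] at hi
        exact Or.inr ⟨i, hi⟩
  have hins : ∀ t, (insert (r t) (occ (copPositions σ r t))).card ≤ c := fun t =>
    (Finset.card_insert_le _ _).trans ((Nat.succ_le_succ (hocc _)).trans hk)
  have hinv : ∀ t, r t ∈ β (occ (copPositions σ r t)) := by
    intro t
    induction t with
    | zero =>
      have : occ (copPositions σ r 0) = ∅ := by
        ext v
        simp [mem_occ, copPositions]
      rwa [this, hr0]
    | succ t ih =>
      rw [hr t]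
      exact hanti _ _ (hmove t) (hins t) (hnext _ _ (hocc _) ih).2
  refine hσ r fun t => ⟨?_, fun i hi => ?_⟩
  · rw [hr t]
    exact (hnext _ _ (hocc _) (hinv t)).1
  · exact Finset.disjoint_left.mp (hβ _ ((hocc _).trans (by omega))).1.1 (hinv (t + 1))
      ((mem_occ _ _).mpr ⟨i, hi⟩)

end Game

/-! ### Counting matchings with few edges leaving a set -/

namespace PerfectMatching

variable {V : Type*}

/-- The vertex matched with `v`. -/
noncomputable def partner (M : PerfectMatching V) (v : V) : V :=
  (SimpleGraph.Subgraph.isPerfectMatching_iff.mp M.2 v).choose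

theorem adj_iff (M : PerfectMatching V) {v w : V} : M.1.Adj v w ↔ M.partner v = w := by
  have h := (SimpleGraph.Subgraph.isPerfectMatching_iff.mp M.2 v).choose_spec
  exact ⟨fun hw => (h.2 w hw).symm, fun hw => hw ▸ h.1⟩

theorem partner_partner (M : PerfectMatching V) (v : V) : M.partner (M.partner v) = v :=
  M.adj_iff.mp (M.adj_iff.mpr rfl).symm

theorem partner_ne (M : PerfectMatching V) (v : V) : M.partner v ≠ v :=
  (M.1.adj_sub (M.adj_iff.mpr rfl)).ne'

theorem partner_injective : Function.Injective (partner (V := V)) := by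
  intro M N h
  apply Subtype.ext
  apply SimpleGraph.Subgraph.ext
  · rw [M.2.2.verts_eq_univ, N.2.2.verts_eq_univ]
  · ext v w
    rw [adj_iff, adj_iff, h]

/-- The perfect matching whose edges join each vertex with its image under an involution. -/
def ofInvolutive (f : V → V) (hf : Function.Involutive f) (hne : ∀ v, f v ≠ v) :
    PerfectMatching V :=
  ⟨{ verts := Set.univ
     Adj := fun v w => f v = w
     adj_sub := fun {v w} h => (SimpleGraph.top_adj v w).mpr fun hvw => hne v (h.trans hvw.symm)
     edge_vert := fun _ => Set.mem_univ _
     symm := ⟨fun v w h => by rw [← h, hf v]⟩ },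
   SimpleGraph.Subgraph.isPerfectMatching_iff.mpr fun v => ⟨f v, rfl, fun _ h => Eq.symm h⟩⟩

theorem partner_ofInvolutive (f : V → V) (hf : Function.Involutive f) (hne : ∀ v, f v ≠ v) :
    (ofInvolutive f hf hne).partner = f :=
  funext fun v => ((ofInvolutive f hf hne).adj_iff (w := f v)).mp rfl

/-- The image of a perfect matching under a permutation of the vertices. -/
noncomputable def relabel (π : Equiv.Perm V) (M : PerfectMatching V) : PerfectMatching V :=
  ofInvolutive (fun v => π (M.partner (π.symm v)))
    (fun v => by simp [partner_partner])
    (fun v h => M.partner_ne (π.symm v) (π.injective (by simpa using h)))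

theorem partner_relabel (π : Equiv.Perm V) (M : PerfectMatching V) (v : V) :
    (M.relabel π).partner v = π (M.partner (π.symm v)) :=
  congrFun (partner_ofInvolutive _ _ _) v

theorem relabel_injective (π : Equiv.Perm V) : Function.Injective (relabel π) := by
  intro M N h
  apply partner_injective
  funext v
  have := congrArg (fun K => partner K (π v)) h
  simpa [partner_relabel] using this

variable [DecidableEq V]

/-- The vertices of `A` that are matched with a vertex outside `A`. -/
noncomputable def leaving (M : PerfectMatching V) (A : Finset V) : Finset V :=
  A.filter fun v => M.partner v ∉ A

theorem leaving_relabel (π : Equiv.Perm V) (M : PerfectMatching V) (A : Finset V) :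
    (M.relabel π).leaving (A.map π.toEmbedding) = (M.leaving A).map π.toEmbedding := by
  ext v
  obtain ⟨u, rfl⟩ := π.surjective v
  simp [leaving, partner_relabel]

/-- The number of sets that have at most `c` leaving vertices. -/
theorem card_filter_leaving_le [Fintype V] (M : PerfectMatching V) (c h : ℕ)
    (hV : Fintype.card V = 2 * h) :
    (Finset.univ.filter fun A : Finset V => (M.leaving A).card ≤ c).card ≤
      2 ^ h * (Finset.univ.filter fun D : Finset V => D.card ≤ c).card := by
  classical
  let e := Fintype.equivFin V
  -- An arbitrary ordering selects one endpoint of each edge. `A` is recovered from `A ∩ T` and its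
  -- leaving vertices, which tell on which edges the two endpoints differ.
  let T : Finset V := Finset.univ.filter fun v => e v < e (M.partner v)
  have hTmem : ∀ v, v ∈ T ↔ e v < e (M.partner v) := fun v => by simp [T]
  have hTc : T.image M.partner = Tᶜ := by
    ext v
    rw [Finset.mem_image, Finset.mem_compl, hTmem, not_lt]
    constructor
    · rintro ⟨u, hu, rfl⟩
      rw [partner_partner]
      exact ((hTmem u).mp hu).le
    · intro hv
      refine ⟨M.partner v, (hTmem _).mpr ?_, M.partner_partner v⟩
      rw [partner_partner]
      exact lt_of_le_of_ne hv fun h => M.partner_ne v (e.injective h)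
  have hT : T.card = h := by
    have h1 : (T.image M.partner).card = T.card :=
      Finset.card_image_of_injective _ fun u v huv => by
        rw [← M.partner_partner u, huv, partner_partner]
    have h2 := Finset.card_add_card_compl T
    rw [← hTc, h1, hV] at h2
    omega
  rw [← hT, ← Finset.card_powerset, ← Finset.card_product]
  refine Finset.card_le_card_of_injOn (fun A => (A ∩ T, M.leaving A)) ?_ ?_
  · intro A hA
    simp only [Finset.coe_filter, Finset.mem_univ, true_and, Set.mem_ofPred_eq] at hA
    simp [hA]
  · intro A _ B _ hAB
    simp only [Prod.mk.injEq] at hAB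
    have hT' : ∀ v ∈ T, (v ∈ A ↔ v ∈ B) := by
      intro v hv
      have := congrArg (fun S => v ∈ S) hAB.1
      simpa [hv] using this
    have hL : ∀ v, (v ∈ A ∧ M.partner v ∉ A ↔ v ∈ B ∧ M.partner v ∉ B) := by
      intro v
      have := congrArg (fun S => v ∈ S) hAB.2
      simpa [leaving] using this
    ext v
    by_cases hv : v ∈ T
    · exact hT' v hv
    · have hv' : M.partner v ∈ T := by
        rw [hTmem, not_lt] at hv
        rw [hTmem, partner_partner]
        exact lt_of_le_of_ne hv fun h => M.partner_ne v (e.injective h)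
      have h1 := hT' _ hv'
      have h2 := hL v
      have h3 := hL (M.partner v)
      rw [partner_partner] at h3
      tauto

theorem exists_perm_map_eq [Fintype V] {A B : Finset V} (h : A.card = B.card) :
    ∃ π : Equiv.Perm V, A.map π.toEmbedding = B := by
  let e : {x // x ∈ A} ≃ {x // x ∈ B} := Finset.equivOfCardEq h
  refine ⟨e.extendSubtype, Finset.eq_of_subset_of_card_le (fun v hv => ?_) ?_⟩
  · obtain ⟨u, hu, rfl⟩ := Finset.mem_map.mp hv
    exact e.extendSubtype_mem u hu
  · rw [Finset.card_map, h]

theorem card_filter_leaving_le_of_card_eq [Fintype V] [Fintype (PerfectMatching V)] (c : ℕ)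
    {A B : Finset V} (h : A.card = B.card) :
    (Finset.univ.filter fun M : PerfectMatching V => (M.leaving A).card ≤ c).card ≤
      (Finset.univ.filter fun M : PerfectMatching V => (M.leaving B).card ≤ c).card := by
  obtain ⟨π, rfl⟩ := exists_perm_map_eq h
  refine Finset.card_le_card_of_injOn (relabel π) ?_ (relabel_injective π).injOn
  intro M hM
  simp only [Finset.coe_filter, Finset.mem_univ, true_and, Set.mem_ofPred_eq] at hM ⊢
  rwa [leaving_relabel, Finset.card_map]

/-- Double counting of pairs (`B`, `M`) with `B` of the size of `A`: the count of matchings is the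
same for every `B`, and each matching admits few sets. -/
theorem choose_mul_card_filter_leaving_le [Fintype V] [Fintype (PerfectMatching V)] (c h : ℕ)
    (hV : Fintype.card V = 2 * h) (A : Finset V) :
    (Fintype.card V).choose A.card *
        (Finset.univ.filter fun M : PerfectMatching V => (M.leaving A).card ≤ c).card ≤
      Fintype.card (PerfectMatching V) *
        (2 ^ h * (Finset.univ.filter fun D : Finset V => D.card ≤ c).card) := by
  classical
  let S : Finset (Finset V) := Finset.powersetCard A.card Finset.univ
  calc (Fintype.card V).choose A.card *
        (Finset.univ.filter fun M : PerfectMatching V => (M.leaving A).card ≤ c).card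
      = ∑ _B ∈ S, (Finset.univ.filter fun M : PerfectMatching V => (M.leaving A).card ≤ c).card := by
        rw [Finset.sum_const, Finset.card_powersetCard, Finset.card_univ, smul_eq_mul]
    _ ≤ ∑ B ∈ S, (Finset.univ.filter fun M : PerfectMatching V => (M.leaving B).card ≤ c).card :=
        Finset.sum_le_sum fun B hB =>
          card_filter_leaving_le_of_card_eq c (Finset.mem_powersetCard.mp hB).2.symm
    _ = ∑ M : PerfectMatching V, (S.filter fun B => (M.leaving B).card ≤ c).card :=
        Finset.sum_card_bipartiteAbove_eq_sum_card_bipartiteBelow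
          (fun B (M : PerfectMatching V) => (M.leaving B).card ≤ c)
    _ ≤ ∑ _M : PerfectMatching V,
          2 ^ h * (Finset.univ.filter fun D : Finset V => D.card ≤ c).card :=
        Finset.sum_le_sum fun M _ =>
          (Finset.card_le_card (Finset.filter_subset_filter _ (Finset.subset_univ S))).trans
            (M.card_filter_leaving_le c h hV)
    _ = _ := by rw [Finset.sum_const, Finset.card_univ, smul_eq_mul]

theorem nonempty_of_even {n : ℕ} (hn : Even n) : Nonempty (PerfectMatching (Fin n)) := by
  obtain ⟨h, rfl⟩ := hn
  let e : Fin h ⊕ Fin h ≃ Fin (h + h) := finSumFinEquiv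
  refine ⟨ofInvolutive (fun v => e (e.symm v).swap) (fun v => by simp) fun v hv => ?_⟩
  have h1 : (e.symm v).swap = e.symm v := by
    have hv' : e (e.symm v).swap = v := hv
    exact e.injective (by rw [hv', e.apply_symm_apply])
  cases hx : e.symm v <;> simp [hx] at h1

end PerfectMatching

/-- A matching edge leaving a set closed off by `C` ends in `C`. -/
theorem card_leaving_le_of_isClosedOff {V : Type*} [DecidableEq V] {M : Fin 3 → PerfectMatching V}
    {C A : Finset V} (hA : (matchingUnion M).IsClosedOff C A) (i : Fin 3) :
    ((M i).leaving A).card ≤ C.card := by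
  refine Finset.card_le_card_of_injOn (M i).partner (fun v hv => ?_) fun u _ v _ huv => ?_
  · rw [Finset.mem_coe, PerfectMatching.leaving, Finset.mem_filter] at hv
    have hadj : (matchingUnion M).Adj v ((M i).partner v) := by
      rw [matchingUnion, SimpleGraph.iSup_adj]
      exact ⟨i, (M i).adj_iff.mpr rfl⟩
    exact (hA.2 v hv.1 _ hadj).resolve_left hv.2
  · rw [← (M i).partner_partner u, huv, PerfectMatching.partner_partner]

/-! ### Binomial estimates -/

theorem six_pow_le_three_mul_choose (m : ℕ) : 6 ^ m ≤ 3 * (3 * m).choose m := by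
  have hstep : ∀ m : ℕ, (3 * (m + 1)).choose (m + 1) * (2 * (m + 1) * (2 * m + 1)) =
      (3 * m).choose m * (3 * (3 * m + 2) * (3 * m + 1)) := by
    intro m
    have h1 := Nat.add_one_mul_choose_eq (3 * m + 2) m
    have h2 := Nat.choose_mul_succ_eq (3 * m) m
    have h3 := Nat.choose_mul_succ_eq (3 * m + 1) m
    have e1 : 3 * m + 1 - m = 2 * m + 1 := by omega
    have e2 : 3 * m + 1 + 1 - m = 2 * m + 2 := by omega
    rw [e1] at h2
    rw [e2] at h3
    have e3 : 3 * (m + 1) = 3 * m + 2 + 1 := by ring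
    rw [e3]
    have h4 : (m + 1) * ((3 * m + 2 + 1).choose (m + 1) * (2 * (m + 1) * (2 * m + 1))) =
        (m + 1) * ((3 * m).choose m * (3 * (3 * m + 2) * (3 * m + 1))) := by
      calc (m + 1) * ((3 * m + 2 + 1).choose (m + 1) * (2 * (m + 1) * (2 * m + 1)))
          = ((3 * m + 2 + 1).choose (m + 1) * (m + 1)) * ((2 * m + 2) * (2 * m + 1)) := by ring
        _ = (3 * m + 3) * ((3 * m + 1 + 1).choose m * (2 * m + 2)) * (2 * m + 1) := by
            rw [← h1]; ring
        _ = (3 * m + 3) * (3 * m + 2) * ((3 * m + 1).choose m * (2 * m + 1)) := by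
            rw [← h3]; ring
        _ = _ := by rw [← h2]; ring
    exact Nat.eq_of_mul_eq_mul_left (Nat.succ_pos m) h4
  have hlarge : ∀ m : ℕ, 4 ≤ m → 6 ^ m ≤ 3 * (3 * m).choose m := by
    intro m hm
    induction m, hm using Nat.le_induction with
    | base => decide +kernel
    | succ m hm ih =>
      refine Nat.le_of_mul_le_mul_right ?_ (show 0 < 2 * (m + 1) * (2 * m + 1) by positivity)
      -- The ratio of consecutive binomials is at least 6 only from `m = 4` on; the factor 3 absorbs
      -- the smaller cases.
      have hr : 6 * (2 * (m + 1) * (2 * m + 1)) ≤ 3 * (3 * m + 2) * (3 * m + 1) := by nlinarith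
      calc 6 ^ (m + 1) * (2 * (m + 1) * (2 * m + 1))
          = 6 ^ m * (6 * (2 * (m + 1) * (2 * m + 1))) := by ring
        _ ≤ (3 * (3 * m).choose m) * (3 * (3 * m + 2) * (3 * m + 1)) := Nat.mul_le_mul ih hr
        _ = _ := by rw [mul_assoc, ← hstep m, ← mul_assoc]
  rcases Nat.lt_or_ge m 4 with hm | hm
  · interval_cases m <;> decide
  · exact hlarge m hm

/-- Unimodality: `a ≤ b ≤ n - a`. A `b` beyond the middle is reflected to `n - b`. -/
theorem Nat.choose_le_choose_of_le_of_add_le {n a b : ℕ} (hab : a ≤ b) (hn : a + b ≤ n) :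
    n.choose a ≤ n.choose b := by
  have key : ∀ b, a ≤ b → 2 * b ≤ n → n.choose a ≤ n.choose b := by
    intro b hab
    induction b, hab using Nat.le_induction with
    | base => exact fun _ => le_rfl
    | succ b _ ih =>
      exact fun hb => (ih (by omega)).trans (Nat.choose_le_succ_of_lt_half_left (by omega))
  rcases Nat.lt_or_ge n (2 * b) with h | h
  · rw [← Nat.choose_symm (show b ≤ n by omega)]
    rcases Nat.lt_or_ge (n - b) a with h' | h'
    · omega
    · exact key _ h' (by omega)
  · exact key b hab h

theorem six_pow_le_three_mul_choose_of_third {n a : ℕ} (h1 : n ≤ 3 * a) (h2 : 3 * a ≤ 2 * n) :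
    6 ^ (n / 3) ≤ 3 * n.choose a :=
  (six_pow_le_three_mul_choose (n / 3)).trans <| Nat.mul_le_mul_left 3 <|
    (Nat.choose_le_choose (n / 3) (by omega)).trans
      (Nat.choose_le_choose_of_le_of_add_le (by omega) (by omega))

/-- Weight each set `D` by `x ^ D.card`, which is at least `x ^ c` on the small sets, and sum by the
binomial theorem. -/
theorem card_filter_card_le_mul_pow {V : Type*} [Fintype V] {x : ℝ} (hx0 : 0 ≤ x) (hx1 : x ≤ 1)
    (c : ℕ) :
    ((Finset.univ.filter fun D : Finset V => D.card ≤ c).card : ℝ) * x ^ c ≤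
      (1 + x) ^ Fintype.card V := by
  classical
  calc ((Finset.univ.filter fun D : Finset V => D.card ≤ c).card : ℝ) * x ^ c
      = ∑ _D ∈ Finset.univ.filter fun D : Finset V => D.card ≤ c, x ^ c := by
        rw [Finset.sum_const, nsmul_eq_mul]
    _ ≤ ∑ D ∈ Finset.univ.filter fun D : Finset V => D.card ≤ c, x ^ D.card :=
        Finset.sum_le_sum fun D hD =>
          pow_le_pow_of_le_one hx0 hx1 (Finset.mem_filter.mp hD).2
    _ ≤ ∑ D : Finset V, x ^ D.card :=
        Finset.sum_le_sum_of_subset_of_nonneg (Finset.filter_subset _ _) fun D _ _ => by positivity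
    _ = (1 + x) ^ Fintype.card V := by
        have := Finset.sum_pow_mul_eq_add_pow x 1 (Finset.univ : Finset V)
        simp only [one_pow, mul_one, Finset.powerset_univ, Finset.card_univ] at this
        rw [this, add_comm]

/-- There are few sets of size at most a small multiple of the number of elements. -/
theorem exists_card_filter_card_le_exp {ε : ℝ} (hε : 0 < ε) :
    ∃ β : ℝ, 0 < β ∧ ∀ n c : ℕ, (c : ℝ) ≤ β * n →
      ((Finset.univ.filter fun D : Finset (Fin n) => D.card ≤ c).card : ℝ) ≤
        Real.exp (ε * n) := by
  -- With `x = exp (-L) ≤ ε / 2`, the factors `(1 + x) ^ n` and `x ^ (-c)` each cost at most `exp (ε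
  -- / 2 * n)`.
  obtain ⟨L, hL0, hL⟩ : ∃ L : ℝ, 0 < L ∧ Real.exp (-L) ≤ ε / 2 := by
    refine ⟨max 1 (-Real.log (ε / 2)), by positivity, ?_⟩
    rw [← Real.le_log_iff_exp_le (by positivity)]
    have := le_max_right 1 (-Real.log (ε / 2))
    linarith
  refine ⟨ε / 2 / L, by positivity, fun n c hc => ?_⟩
  have h1 := card_filter_card_le_mul_pow (V := Fin n) (Real.exp_pos (-L)).le
    (Real.exp_le_one_iff.mpr (by linarith)) c
  rw [Fintype.card_fin, ← Real.exp_nat_mul] at h1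
  have h2 : (1 + Real.exp (-L)) ^ n ≤ Real.exp (ε / 2 * n) := by
    rw [mul_comm, Real.exp_nat_mul]
    gcongr
    have := Real.add_one_le_exp (ε / 2)
    linarith
  have h3 : (c : ℝ) * L ≤ ε / 2 * n := by
    rw [div_mul_eq_mul_div, le_div_iff₀ hL0] at hc
    exact hc
  refine le_of_mul_le_mul_right (h1.trans (h2.trans ?_)) (Real.exp_pos (c * -L))
  rw [← Real.exp_add]
  apply Real.exp_le_exp.mpr
  linarith

/-! ### Probability bounds and the union bound -/

theorem uniformOn_real_leaving_le {h c : ℕ} (A : Finset (Fin (2 * h))) :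
    (uniformOn Set.univ : Measure (PerfectMatching (Fin (2 * h)))).real
        {M | (M.leaving A).card ≤ c} ≤
      2 ^ h * (Finset.univ.filter fun D : Finset (Fin (2 * h)) => D.card ≤ c).card /
        ((2 * h).choose A.card : ℝ) := by
  classical
  let : Fintype (PerfectMatching (Fin (2 * h))) := Fintype.ofFinite _
  have : Nonempty (PerfectMatching (Fin (2 * h))) :=
    PerfectMatching.nonempty_of_even (even_two_mul h)
  have h1 := PerfectMatching.choose_mul_card_filter_leaving_le c h (Fintype.card_fin (2 * h)) A
  rw [Fintype.card_fin] at h1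
  have h2 : (0 : ℝ) < Fintype.card (PerfectMatching (Fin (2 * h))) :=
    Nat.cast_pos.mpr Fintype.card_pos
  have h3 : (0 : ℝ) < (2 * h).choose A.card :=
    Nat.cast_pos.mpr (Nat.choose_pos ((Finset.card_le_univ A).trans_eq (Fintype.card_fin _)))
  have h4 : {M : PerfectMatching (Fin (2 * h)) | (M.leaving A).card ≤ c} =
      ((Finset.univ.filter fun M : PerfectMatching (Fin (2 * h)) =>
        (M.leaving A).card ≤ c : Finset _) : Set _) := by
    ext M
    simp
  rw [measureReal_def, uniformOn_univ, h4, Measure.count_apply_finset, ENNReal.toReal_div,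
    ENNReal.toReal_natCast, ENNReal.toReal_natCast, div_le_div_iff₀ h2 h3]
  rw [mul_comm, mul_comm (_ * _)]
  exact_mod_cast h1

theorem threeMatchings_real_forall_le {n : ℕ} [Nonempty (PerfectMatching (Fin n))]
    (E : Set (PerfectMatching (Fin n))) :
    (threeMatchings n).real {M | ∀ i, M i ∈ E} =
      ((uniformOn Set.univ : Measure (PerfectMatching (Fin n))).real E) ^ 3 := by
  have : {M : Fin 3 → PerfectMatching (Fin n) | ∀ i, M i ∈ E} = Set.pi Set.univ fun _ => E := by
    ext M
    simp
  rw [measureReal_def, this, threeMatchings, Measure.pi_pi, ENNReal.toReal_prod,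
    Finset.prod_const, Finset.card_univ, Fintype.card_fin, measureReal_def]

instance {n : ℕ} [Nonempty (PerfectMatching (Fin n))] : IsProbabilityMeasure (threeMatchings n) := by
  unfold threeMatchings
  infer_instance

theorem threeMatchings_real_not_noBalancedSeparator_le (h c : ℕ) :
    (threeMatchings (2 * h)).real {M | ¬ (matchingUnion M).NoBalancedSeparator c} ≤
      2 ^ (2 * h) * (2 ^ h * (Finset.univ.filter fun D : Finset (Fin (2 * h)) => D.card ≤ c).card /
        (6 ^ (2 * h / 3) / 3)) ^ 3 := by
  classical
  have : Nonempty (PerfectMatching (Fin (2 * h))) :=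
    PerfectMatching.nonempty_of_even (even_two_mul h)
  let S : Finset (Finset (Fin (2 * h))) :=
    Finset.univ.filter fun A => 2 * h ≤ 3 * A.card ∧ 3 * A.card ≤ 2 * (2 * h)
  set K : ℝ := 2 ^ h * (Finset.univ.filter fun D : Finset (Fin (2 * h)) => D.card ≤ c).card
  have hK : 0 ≤ K := by positivity
  have hsub : {M | ¬ (matchingUnion M).NoBalancedSeparator c} ⊆
      ⋃ A ∈ S, {M : Fin 3 → PerfectMatching (Fin (2 * h)) |
        ∀ i, M i ∈ {M | (M.leaving A).card ≤ c}} := by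
    intro M hM
    simp only [SimpleGraph.NoBalancedSeparator, Fintype.card_fin, Set.mem_ofPred_eq] at hM
    push Not at hM
    obtain ⟨C, A, hC, hA, h1, h2⟩ := hM
    simp only [Set.mem_iUnion]
    exact ⟨A, Finset.mem_filter.mpr ⟨Finset.mem_univ A, h1, h2⟩, fun i =>
      (card_leaving_le_of_isClosedOff hA i).trans hC⟩
  calc (threeMatchings (2 * h)).real {M | ¬ (matchingUnion M).NoBalancedSeparator c}
      ≤ ∑ A ∈ S, (threeMatchings (2 * h)).real {M | ∀ i, M i ∈ {M | (M.leaving A).card ≤ c}} :=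
        (measureReal_mono hsub (measure_ne_top _ _)).trans (measureReal_biUnion_finset_le _ _)
    _ ≤ ∑ _A ∈ S, (K / (6 ^ (2 * h / 3) / 3)) ^ 3 := by
        refine Finset.sum_le_sum fun A hA => ?_
        have hA' := (Finset.mem_filter.mp hA).2
        have h6 : (6 : ℝ) ^ (2 * h / 3) ≤ 3 * (2 * h).choose A.card := by
          exact_mod_cast six_pow_le_three_mul_choose_of_third hA'.1 hA'.2
        rw [threeMatchings_real_forall_le]
        refine pow_le_pow_left₀ measureReal_nonneg ((uniformOn_real_leaving_le A).trans ?_) 3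
        exact div_le_div_of_nonneg_left hK (by positivity) (by linarith)
    _ ≤ _ := by
        rw [Finset.sum_const, nsmul_eq_mul]
        refine mul_le_mul_of_nonneg_right ?_ (by positivity)
        have : S.card ≤ 2 ^ (2 * h) := by
          refine (Finset.card_le_univ S).trans_eq ?_
          rw [Fintype.card_finset, Fintype.card_fin]
        exact_mod_cast this

/-- There is a balanced separator of small linear size with exponentially small probability. -/
theorem exists_threeMatchings_real_not_noBalancedSeparator_le :
    ∃ β : ℝ, 0 < β ∧ ∀ h c : ℕ, (c : ℝ) ≤ β * (2 * h : ℕ) →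
      (threeMatchings (2 * h)).real {M | ¬ (matchingUnion M).NoBalancedSeparator c} ≤
        972 * Real.exp (-(7 / 180) * (2 * h : ℕ)) := by
  obtain ⟨β, hβ, hD⟩ := exists_card_filter_card_le_exp (ε := 1 / 180) (by norm_num)
  refine ⟨β, hβ, fun h c hc => (threeMatchings_real_not_noBalancedSeparator_le h c).trans ?_⟩
  -- Rounding in `2 * h / 3` costs 6² = 36, and 972 = 27 · 36. The rate is 7/180 = 1/18 − 3/180,
  -- where 1/18 comes from 32/36 = 1 − 1/9 ≤ exp(−1/9) per two vertices.
  have h6 : (36 : ℝ) ^ h ≤ 36 * (6 ^ (2 * h / 3)) ^ 3 := by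
    calc (36 : ℝ) ^ h = 6 ^ (2 * h) := by rw [pow_mul]; norm_num
      _ ≤ 6 ^ (2 + (2 * h / 3) * 3) := pow_le_pow_right₀ (by norm_num) (by omega)
      _ = _ := by rw [pow_add, pow_mul]; norm_num
  have h8 : (32 : ℝ) ^ h ≤ 36 ^ h * Real.exp (-(1 / 18) * (2 * h : ℕ)) := by
    have : Real.exp (-(1 / 18) * (2 * h : ℕ)) = Real.exp (-(1 / 9)) ^ h := by
      rw [← Real.exp_nat_mul]
      push_cast
      ring_nf
    rw [this, ← mul_pow]
    gcongr
    have := Real.add_one_le_exp (-(1 / 9) : ℝ)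
    linarith
  have hD' := hD (2 * h) c hc
  set D : ℝ := ((Finset.univ.filter fun D : Finset (Fin (2 * h)) => D.card ≤ c).card : ℝ)
  have hD3 : D ^ 3 ≤ Real.exp (1 / 60 * (2 * h : ℕ)) := by
    calc D ^ 3 ≤ Real.exp (1 / 180 * (2 * h : ℕ)) ^ 3 :=
          pow_le_pow_left₀ (Nat.cast_nonneg _) hD' 3
      _ = _ := by
          rw [← Real.exp_nat_mul]
          push_cast
          ring_nf
  have hpos : (0 : ℝ) < (6 ^ (2 * h / 3)) ^ 3 := by positivity
  calc (2 : ℝ) ^ (2 * h) * (2 ^ h * D / (6 ^ (2 * h / 3) / 3)) ^ 3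
      = 27 * 32 ^ h * D ^ 3 / (6 ^ (2 * h / 3)) ^ 3 := by
        have : (32 : ℝ) ^ h = 2 ^ (2 * h) * (2 ^ h) ^ 3 := by
          rw [← pow_mul, ← pow_add, show 2 * h + h * 3 = 5 * h by ring, pow_mul]
          norm_num
        rw [this]
        field_simp
        ring
    _ ≤ 972 * (Real.exp (-(1 / 18) * (2 * h : ℕ)) * Real.exp (1 / 60 * (2 * h : ℕ))) := by
        rw [div_le_iff₀ hpos]
        calc 27 * 32 ^ h * D ^ 3
            ≤ 27 * (36 * (6 ^ (2 * h / 3)) ^ 3 * Real.exp (-(1 / 18) * (2 * h : ℕ))) *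
                Real.exp (1 / 60 * (2 * h : ℕ)) := by
              gcongr
              exact h8.trans (by gcongr)
          _ = _ := by ring
    _ = _ := by
        rw [← Real.exp_add]
        ring_nf

theorem mainTheorem1 :
    ∃ α : ℝ, 0 < α ∧
      -- with high probability, as `n → ∞` along the even integers
      Tendsto (fun n : ℕ => (threeMatchings n).real
          {M | ∀ k : ℕ, (k : ℝ) ≤ α * n → ¬ CopsSuffice (matchingUnion M) k})
        (atTop ⊓ 𝓟 {n : ℕ | Even n}) (𝓝 1) ∧
      -- in fact with probability `1 - exp (-Ω(n))`
      ∃ c : ℝ, 0 < c ∧ ∃ n₀ : ℕ, ∀ n : ℕ, n₀ ≤ n → Even n →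
        1 - Real.exp (-c * n) ≤ (threeMatchings n).real
          {M | ∀ k : ℕ, (k : ℝ) ≤ α * n → ¬ CopsSuffice (matchingUnion M) k} := by
  obtain ⟨β, hβ, hbad⟩ := exists_threeMatchings_real_not_noBalancedSeparator_le
  -- The bound 1/4 ensures `3 * c < n`.
  set γ : ℝ := min β (1 / 4)
  have hγ : 0 < γ := by positivity
  have hmain : ∃ n₀ : ℕ, ∀ n : ℕ, n₀ ≤ n → Even n →
      1 - Real.exp (-(1 / 100) * n) ≤ (threeMatchings n).real
        {M | ∀ k : ℕ, (k : ℝ) ≤ γ / 2 * n → ¬ CopsSuffice (matchingUnion M) k} := by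
    -- `γ * n > 2` makes room for `k + 1 ≤ γ * n` when `k ≤ γ / 2 * n`; 97200 = 972 · 100 lets `exp
    -- (n / 100)` absorb the constant 972.
    obtain ⟨n₁, hn₁⟩ := exists_nat_gt (2 / γ)
    refine ⟨max n₁ 97200, fun n hn hev => ?_⟩
    obtain ⟨h, rfl⟩ := hev.exists_two_nsmul
    rw [smul_eq_mul] at hn hev ⊢
    have : Nonempty (PerfectMatching (Fin (2 * h))) := PerfectMatching.nonempty_of_even hev
    have hn1 : (n₁ : ℝ) ≤ (2 * h : ℕ) := by exact_mod_cast (le_max_left _ _).trans hn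
    have hn2 : (97200 : ℝ) ≤ (2 * h : ℕ) := by exact_mod_cast (le_max_right _ _).trans hn
    set n : ℕ := 2 * h with hn_def
    set c : ℕ := ⌊γ * n⌋₊
    have hcle : (c : ℝ) ≤ γ * n := Nat.floor_le (by positivity)
    have hb := hbad h c (hcle.trans (by gcongr; exact min_le_left _ _))
    rw [← hn_def] at hb
    have h3c : 3 * c < Fintype.card (Fin n) := by
      rw [Fintype.card_fin]
      have : γ * n ≤ 1 / 4 * n := by gcongr; exact min_le_right _ _
      have : (3 : ℝ) * c < n := by linarith
      exact_mod_cast this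
    have hsub : {M | ¬ (matchingUnion M).NoBalancedSeparator c}ᶜ ⊆
        {M : Fin 3 → PerfectMatching (Fin n) |
          ∀ k : ℕ, (k : ℝ) ≤ γ / 2 * n → ¬ CopsSuffice (matchingUnion M) k} := by
      intro M hM k hk
      rw [Set.mem_compl_iff, Set.mem_ofPred_eq, not_not] at hM
      refine hM.not_copsSuffice h3c (Nat.le_floor ?_)
      have : 2 < γ * n := by
        rw [div_lt_iff₀ hγ] at hn₁
        nlinarith
      push_cast
      linarith
    have hexp : 972 * Real.exp (-(7 / 180) * n) ≤ Real.exp (-(1 / 100) * n) := by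
      have h1 : (972 : ℝ) ≤ Real.exp (1 / 100 * n) := by
        have := Real.add_one_le_exp (1 / 100 * n : ℝ)
        linarith
      calc 972 * Real.exp (-(7 / 180) * n)
          ≤ Real.exp (1 / 100 * n) * Real.exp (-(7 / 180) * n) := by gcongr
        _ = Real.exp (1 / 100 * n + -(7 / 180) * n) := (Real.exp_add _ _).symm
        _ ≤ Real.exp (-(1 / 100) * n) := Real.exp_le_exp.mpr (by linarith)
    have hcompl : (threeMatchings n).real {M | ¬ (matchingUnion M).NoBalancedSeparator c}ᶜ =
        1 - (threeMatchings n).real {M | ¬ (matchingUnion M).NoBalancedSeparator c} :=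
      probReal_compl_eq_one_sub (Set.toFinite _).measurableSet
    have := measureReal_mono (μ := threeMatchings n) hsub
    linarith
  refine ⟨γ / 2, by positivity, ?_, 1 / 100, by norm_num, hmain⟩
  obtain ⟨n₀, hn₀⟩ := hmain
  have hlim : Tendsto (fun n : ℕ => 1 - Real.exp (-(1 / 100) * n)) (atTop ⊓ 𝓟 {n : ℕ | Even n})
      (𝓝 1) := by
    have h1 : Tendsto (fun n : ℕ => -(1 / 100 : ℝ) * n) atTop atBot :=
      tendsto_natCast_atTop_atTop.const_mul_atTop_of_neg (by norm_num)
    simpa using ((Real.tendsto_exp_atBot.comp h1).const_sub 1).mono_left inf_le_left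
  refine tendsto_of_tendsto_of_tendsto_of_le_of_le' hlim tendsto_const_nhds ?_ ?_
  · rw [eventually_inf_principal]
    filter_upwards [eventually_ge_atTop n₀] with n hn hev using hn₀ n hn hev
  · rw [eventually_inf_principal]
    refine Eventually.of_forall fun n hev => ?_
    have : Nonempty (PerfectMatching (Fin n)) := PerfectMatching.nonempty_of_even hev
    exact measureReal_le_one
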